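/- Let $\mathbb M_{n_1,n_2}$ be the space of real or complex $n_1\times n_2$ matrices with the inner product $\langle X,Y\rangle=\mathrm{Re}\,\mathrm{tr}(X^*Y)$ and its Frobenius norm $\|\cdot\|$. Let $E$ be a finite-dimensional real inner product space (e.g. $\mathbb R^m$, or $\mathbb C^m$ with the real part of its inner product), let $\mathcal A:\mathbb M_{n_1,n_2}\to E$ be a real-linear operator with adjoint $\mathcal A^*$ and operator norm $\|\mathcal A\|$, let $b\in E$ and let $K\ge 1$ be an integer. (Complex-linear operators into $\mathbb C^m$ are a special case, with the same norm and adjoint.) Let $\iota_{R_K}(X)=0$ if $\mathrm{rank}(X)\le K$ and $\iota_{R_K}(X)=+\infty$ otherwise. For a functional $f$ with extended real values put $\mathcal S_2(f)(Y)=\sup_X\big(-f(X)-\|X-Y\|^2\big)$ and let $\mathcal Q_2=\mathcal S_2\circ\mathcal S_2$ be the quadratic envelope. Define $$\mathcal R_{K,reg}(X)=\mathcal Q_2(\iota_{R_K})(X)+\|\mathcal AX-b\|^2 .$$ For an integer $k\ge1$ define the lower restricted isometry constant $\delta_k^-$ by $$1-\delta_k^-=\inf\Big\{\frac{\|\mathcal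 AX\|^2}{\|X\|^2}:\ X\ne0,\ \mathrm{rank}(X)\le k\Big\},$$ where the infimum of the empty set, which occurs only if $\mathbb M_{n_1,n_2}=\{0\}$, is taken to be $0$. Let $\sigma_1(Z)\ge\sigma_2(Z)\ge\dots$ be the singular values of $Z$, with $\sigma_j(Z)=0$ for $j>\min(n_1,n_2)$. Suppose that $\|\mathcal A\|<1$. 1. If $\delta_K^-<1$, then $\mathcal R_{K,reg}$ has a global minimizer. 2. Let $X'$ be a global minimizer of $\mathcal R_{K,reg}$ and put $Z'=(I-\mathcal A^*\mathcal A)X'+\mathcal A^*b$. If $$\sigma_{K+1}(Z')<(1-2\delta_{2K}^-)\,\sigma_K(Z'),$$ then $X'$ is the unique global minimizer of $\mathcal R_{K,reg}$, and $\mathcal R_{K,reg}$ has no local minimizer other than $X'$. -/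

import Mathlib

open scoped Matrix

/-! Matrices carry the Frobenius norm throughout; `𝕜` is `ℝ` or `ℂ`. -/

attribute [local instance] Matrix.frobeniusNormedAddCommGroup Matrix.frobeniusNormedSpace

namespace LowRank

theorem frobenius_norm_sq_eq_trace {𝕜 : Type*} [RCLike 𝕜] {m n : ℕ}
    (X : Matrix (Fin m) (Fin n) 𝕜) :
    ‖X‖ ^ 2 = RCLike.re (Matrix.trace (Xᴴ * X)) := by
  have h0 : 0 ≤ ∑ i, ∑ j, ‖X i j‖ ^ (2 : ℝ) := by positivity
  rw [Matrix.frobenius_norm_def, ← Real.sqrt_eq_rpow, Real.sq_sqrt h0, Finset.sum_comm]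
  simp only [Matrix.trace, Matrix.diag, Matrix.mul_apply, Matrix.conjTranspose_apply, map_sum]
  refine Finset.sum_congr rfl fun j _ => Finset.sum_congr rfl fun i _ => ?_
  rw [RCLike.star_def, RCLike.conj_mul, Real.rpow_two]
  norm_cast

/-- The real inner product `Re tr (Xᴴ Y)` on matrices over `𝕜`, inducing the Frobenius norm. -/
noncomputable instance frobeniusInner {𝕜 : Type*} [RCLike 𝕜] {m n : ℕ} :
    InnerProductSpace ℝ (Matrix (Fin m) (Fin n) 𝕜) :=
  { (inferInstance : NormedSpace ℝ (Matrix (Fin m) (Fin n) 𝕜)) with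
    inner := fun X Y => RCLike.re (Matrix.trace (Xᴴ * Y))
    norm_sq_eq_re_inner := fun X => frobenius_norm_sq_eq_trace X
    conj_inner_symm := fun X Y => by
      have h : Matrix.trace (Xᴴ * Y) = star (Matrix.trace (Yᴴ * X)) := by
        rw [← Matrix.trace_conjTranspose, Matrix.conjTranspose_mul,
          Matrix.conjTranspose_conjTranspose]
      simp [h]
    add_left := fun X Y Z => by
      simp [Matrix.conjTranspose_add, Matrix.add_mul, Matrix.trace_add]
    smul_left := fun X Y r => by
      simp [Matrix.conjTranspose_smul, Matrix.trace_smul, RCLike.smul_re] }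

/-- `𝒮_γ(f)(Y) = sup_X (-f(X) - (γ/2) ‖X - Y‖²)`. -/
noncomputable def quadTransform {V : Type*} [NormedAddCommGroup V] (γ : ℝ) (f : V → EReal) :
    V → EReal :=
  fun Y => ⨆ X : V, (-f X - ((γ / 2 * ‖X - Y‖ ^ 2 : ℝ) : EReal))

/-- The quadratic envelope `𝒬_γ = 𝒮_γ ∘ 𝒮_γ`. -/
noncomputable def quadEnvelope {V : Type*} [NormedAddCommGroup V] (γ : ℝ) (f : V → EReal) :
    V → EReal :=
  quadTransform γ (quadTransform γ f)

/-- The indicator functional `ι_{R_K}` of the matrices of rank at most `K`. -/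
noncomputable def rankIndicator {𝕜 : Type*} [RCLike 𝕜] {m n : ℕ} (K : ℕ)
    (X : Matrix (Fin m) (Fin n) 𝕜) : EReal :=
  if X.rank ≤ K then 0 else ⊤

/-- The operator norm of a linear map between finite-dimensional inner product spaces. -/
noncomputable def opNorm {V W : Type*} [NormedAddCommGroup V] [InnerProductSpace ℝ V]
    [FiniteDimensional ℝ V] [NormedAddCommGroup W] [InnerProductSpace ℝ W] (A : V →ₗ[ℝ] W) : ℝ :=
  ‖LinearMap.toContinuousLinearMap A‖

/-- The lower restricted isometry constant `δ_K⁻` of `A`: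
`1 - δ_K⁻ = inf {‖A X‖² / ‖X‖² : X ≠ 0, rank X ≤ K}`. -/
noncomputable def lrip {𝕜 : Type*} [RCLike 𝕜] {m n : ℕ} {E : Type*} [NormedAddCommGroup E]
    [InnerProductSpace ℝ E] (A : Matrix (Fin m) (Fin n) 𝕜 →ₗ[ℝ] E) (K : ℕ) : ℝ :=
  1 - sInf {r : ℝ | ∃ X : Matrix (Fin m) (Fin n) 𝕜,
    X ≠ 0 ∧ X.rank ≤ K ∧ r = ‖A X‖ ^ 2 / ‖X‖ ^ 2}

/-- The `j`-th largest singular value, `j = 1, 2, …` (Mathlib numbers them from `0`);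
it is `0` beyond the size of the matrix. -/
noncomputable def sigma {𝕜 : Type*} [RCLike 𝕜] {m n : ℕ} (j : ℕ)
    (Z : Matrix (Fin m) (Fin n) 𝕜) : ℝ :=
  (Matrix.toEuclideanLin Z).singularValues (j - 1)

/-- The regularized objective `𝒬₂(ι_{R_K})(X) + ‖A X - b‖²`. -/
noncomputable def regObjective {𝕜 : Type*} [RCLike 𝕜] {m n : ℕ} {E : Type*}
    [NormedAddCommGroup E] [InnerProductSpace ℝ E] (A : Matrix (Fin m) (Fin n) 𝕜 →ₗ[ℝ] E)
    (b : E) (K : ℕ) (X : Matrix (Fin m) (Fin n) 𝕜) : EReal :=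
  quadEnvelope 2 (rankIndicator K) X + ((‖A X - b‖ ^ 2 : ℝ) : EReal)

/-- The point `Z = (I - A⋆A) X + A⋆ b` associated with `X`. -/
noncomputable def assocPoint {𝕜 : Type*} [RCLike 𝕜] {m n : ℕ} {E : Type*}
    [NormedAddCommGroup E] [InnerProductSpace ℝ E] [FiniteDimensional ℝ E]
    (A : Matrix (Fin m) (Fin n) 𝕜 →ₗ[ℝ] E) (b : E) (X : Matrix (Fin m) (Fin n) 𝕜) :
    Matrix (Fin m) (Fin n) 𝕜 :=
  (X - LinearMap.adjoint A (A X)) + LinearMap.adjoint A b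

end LowRank

/-! For a closed set `C`, `𝒬₂(ι_C)(X) = sup_Y (dist(Y, C)² - ‖Y - X‖²)`. If `‖𝒜‖ ≤ 1`, moving from
`X` towards a point of `C` nearest to the associated point `Z` never increases the objective. Hence
the least squares minimizers over `C` are global minimizers, and at a local minimizer the supremum
is attained at `Z`, which is also the associated point of one of its own nearest points in `C`.

For `C = {rank ≤ K}`, the truncated singular value decomposition of `Z` is a proximal point of `C`
with constant `σ_{K+1}(Z) / σ_K(Z)`, by the Eckart-Young theorem for `Z` with its discarded part
magnified. Proximal normals with constants `c` and `c'` are monotone up to `(c + c') / 2`, and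
residuals differ by `𝒜⋆𝒜` applied to a matrix of rank at most `2K`; the gap condition makes these
two estimates incompatible unless the points coincide.
-/

namespace LowRank

open Filter Topology Metric

section IndicatorEnvelope

variable {V : Type*} [NormedAddCommGroup V] {C : Set V}

/-- The quadratic envelope `𝒬₂(ι_C)` of the indicator functional of `C`: since
`𝒮₂(ι_C) = -dist(·, C)²`, it is `sup_Y (dist(Y, C)² - ‖Y - X‖²)`. It has the junk value `0` where
that supremum is infinite. -/
noncomputable def indicatorEnvelope (C : Set V) (X : V) : ℝ :=
  ⨆ Y : V, (infDist Y C ^ 2 - ‖Y - X‖ ^ 2)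

/-- Finiteness at `X` of the quadratic envelope of the indicator functional of `C`. -/
def HasFiniteEnvelope (C : Set V) (X : V) : Prop :=
  BddAbove (Set.range fun Y : V => infDist Y C ^ 2 - ‖Y - X‖ ^ 2)

theorem infDist_sq_le {W : V} (hW : W ∈ C) (Y : V) : infDist Y C ^ 2 ≤ ‖Y - W‖ ^ 2 :=
  pow_le_pow_left₀ infDist_nonneg (dist_eq_norm Y W ▸ infDist_le_dist_of_mem hW) 2

theorem le_infDist_sq (hne : C.Nonempty) {r : ℝ} {Y : V} (h : ∀ W ∈ C, r ≤ ‖Y - W‖ ^ 2) :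
    r ≤ infDist Y C ^ 2 := by
  rw [← Real.sqrt_le_left infDist_nonneg, le_infDist hne]
  intro W hW
  rw [dist_eq_norm, Real.sqrt_le_left (norm_nonneg _)]
  exact h W hW

theorem hasFiniteEnvelope_of_mem {W : V} (hW : W ∈ C) : HasFiniteEnvelope C W :=
  ⟨0, by rintro _ ⟨Y, rfl⟩; exact sub_nonpos.2 (infDist_sq_le hW Y)⟩

theorem indicatorEnvelope_nonpos_of_mem {W : V} (hW : W ∈ C) : indicatorEnvelope C W ≤ 0 :=
  ciSup_le fun Y => sub_nonpos.2 (infDist_sq_le hW Y)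

theorem HasFiniteEnvelope.le_indicatorEnvelope {X : V} (hX : HasFiniteEnvelope C X) (Y : V) :
    infDist Y C ^ 2 - ‖Y - X‖ ^ 2 ≤ indicatorEnvelope C X :=
  le_ciSup hX Y

theorem quadTransform_indicator [ProperSpace V] (hC : IsClosed C) (hne : C.Nonempty)
    {γ : ℝ} (hγ : 0 ≤ γ) (Y : V) :
    quadTransform γ (Cᶜ.indicator ⊤) Y = ((-(γ / 2 * infDist Y C ^ 2) : ℝ) : EReal) := by
  refine le_antisymm (iSup_le fun X => ?_) ?_
  · by_cases hX : X ∈ C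
    · rw [Set.indicator_of_notMem (Set.notMem_compl_iff.2 hX), neg_zero, zero_sub,
        ← EReal.coe_neg, EReal.coe_le_coe_iff, norm_sub_rev]
      exact neg_le_neg (mul_le_mul_of_nonneg_left (infDist_sq_le hX Y) (by positivity))
    · rw [Set.indicator_of_mem hX, Pi.top_apply, EReal.neg_top, EReal.bot_sub]
      exact bot_le
  · obtain ⟨W, hW, hYW⟩ := hC.exists_infDist_eq_dist hne Y
    refine le_iSup_of_le W ?_
    rw [Set.indicator_of_notMem (Set.notMem_compl_iff.2 hW), neg_zero, zero_sub, ← EReal.coe_neg,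
      hYW, dist_comm, dist_eq_norm]

theorem quadEnvelope_indicator [ProperSpace V] (hC : IsClosed C) (hne : C.Nonempty) {X : V}
    (hX : HasFiniteEnvelope C X) :
    quadEnvelope 2 (Cᶜ.indicator ⊤) X = (indicatorEnvelope C X : EReal) := by
  rw [indicatorEnvelope, EReal.coe_strictMono.monotone.map_ciSup_of_continuousAt
    continuous_coe_real_ereal.continuousAt hX]
  refine iSup_congr fun Y => ?_
  rw [quadTransform_indicator hC hne two_pos.le, ← EReal.coe_neg, ← EReal.coe_sub]
  norm_num

variable [InnerProductSpace ℝ V]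

theorem norm_sub_segment_sq (U X Y : V) (t : ℝ) :
    ‖U - (X + t • (Y - X))‖ ^ 2 =
      (1 - t) * ‖U - X‖ ^ 2 + t * ‖U - Y‖ ^ 2 - t * (1 - t) * ‖Y - X‖ ^ 2 := by
  have hY : U - Y = (U - X) - (Y - X) := by abel
  rw [hY, ← sub_sub, norm_sub_sq_real, norm_sub_sq_real (U - X), norm_smul, inner_smul_right,
    mul_pow, Real.norm_eq_abs, sq_abs]
  ring

theorem HasFiniteEnvelope.indicatorEnvelope_segment_le {X Y : V} (hX : HasFiniteEnvelope C X)
    (hY : HasFiniteEnvelope C Y) {t : ℝ} (h0 : 0 ≤ t) (h1 : t ≤ 1) :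
    indicatorEnvelope C (X + t • (Y - X)) ≤
      (1 - t) * indicatorEnvelope C X + t * indicatorEnvelope C Y +
        t * (1 - t) * ‖Y - X‖ ^ 2 := by
  refine ciSup_le fun U => ?_
  have hUX := mul_le_mul_of_nonneg_left (hX.le_indicatorEnvelope U) (sub_nonneg.2 h1)
  have hUY := mul_le_mul_of_nonneg_left (hY.le_indicatorEnvelope U) h0
  rw [norm_sub_segment_sq]
  linarith

theorem convex_hasFiniteEnvelope (C : Set V) : Convex ℝ {X | HasFiniteEnvelope C X} := by
  refine convex_iff_add_mem.2 fun X ⟨M, hM⟩ Y ⟨N, hN⟩ s t hs ht hst =>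
    ⟨s * M + t * N + t * s * ‖Y - X‖ ^ 2, ?_⟩
  rintro _ ⟨U, rfl⟩
  obtain rfl : s = 1 - t := by linarith
  have hXY : (1 - t) • X + t • Y = X + t • (Y - X) := by module
  have hUX := mul_le_mul_of_nonneg_left (hM ⟨U, rfl⟩) hs
  have hUY := mul_le_mul_of_nonneg_left (hN ⟨U, rfl⟩) ht
  simp only at hUX hUY ⊢
  rw [hXY, norm_sub_segment_sq]
  linarith

theorem hasFiniteEnvelope_of_span_eq_top (hne : C.Nonempty)
    (hC : ∀ W ∈ C, ∀ t : ℝ, t • W ∈ C) (hspan : Submodule.span ℝ C = ⊤) (X : V) :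
    HasFiniteEnvelope C X := by
  obtain ⟨W₀, hW₀⟩ := hne
  suffices h : ∀ t : ℝ, HasFiniteEnvelope C (t • X) by simpa using h 1
  have hX : X ∈ Submodule.span ℝ C := hspan ▸ Submodule.mem_top
  induction hX using Submodule.span_induction with
  | mem W hW => exact fun t => hasFiniteEnvelope_of_mem (hC W hW t)
  | zero => exact fun t => hasFiniteEnvelope_of_mem (by simpa using hC W₀ hW₀ 0)
  | add X Y _ _ hX hY =>
    intro t
    have h := convex_hasFiniteEnvelope C (hX (2 * t)) (hY (2 * t)) (a := 1 / 2) (b := 1 / 2)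
      (by norm_num) (by norm_num) (by norm_num)
    simpa [smul_smul, ← smul_add] using h
  | smul s X _ hX => exact fun t => smul_smul t s X ▸ hX (t * s)

end IndicatorEnvelope

section ProximalNormal

variable {V : Type*} [NormedAddCommGroup V] [InnerProductSpace ℝ V] {C : Set V} {c : ℝ} {X N : V}

/-- `N` is a proximal normal to `C` at `X ∈ C` with constant `c`. For `0 < c` this says that `X` is
a point of `C` nearest to `X + c⁻¹ • N`; in particular `c = 1` encodes that `X` is nearest to
`X + N`. -/
structure IsProximalNormal (C : Set V) (c : ℝ) (X N : V) : Prop where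
  mem : X ∈ C
  two_mul_inner_le : ∀ W ∈ C, 2 * inner ℝ N (W - X) ≤ c * ‖W - X‖ ^ 2

theorem norm_add_sub_sq (X N W : V) :
    ‖X + N - W‖ ^ 2 = ‖N‖ ^ 2 - 2 * inner ℝ N (W - X) + ‖W - X‖ ^ 2 := by
  rw [← norm_sub_sq_real]
  congr 2
  abel

theorem exists_isProximalNormal_one [ProperSpace V] (hC : IsClosed C) (hne : C.Nonempty) (Z : V) :
    ∃ X, IsProximalNormal C 1 X (Z - X) := by
  obtain ⟨X, hX, hZX⟩ := hC.exists_infDist_eq_dist hne Z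
  refine ⟨X, hX, fun W hW => ?_⟩
  have hle := infDist_sq_le hW Z
  rw [hZX, dist_eq_norm] at hle
  have hZW := norm_add_sub_sq X (Z - X) W
  rw [add_sub_cancel] at hZW
  linarith

theorem IsProximalNormal.le_infDist_sq (h : IsProximalNormal C c X N) (hc : c ≤ 1) (U : V) :
    ‖N + (1 - c) • U‖ ^ 2 - (1 - c) * ‖U‖ ^ 2 ≤ infDist (X + (N + (1 - c) • U)) C ^ 2 := by
  refine LowRank.le_infDist_sq ⟨X, h.mem⟩ fun W hW => ?_
  have hgap : 0 ≤ (1 - c) * ‖W - X - U‖ ^ 2 := mul_nonneg (sub_nonneg.2 hc) (sq_nonneg _)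
  have hnormal := h.two_mul_inner_le W hW
  rw [norm_sub_sq_real, real_inner_comm] at hgap
  rw [norm_add_sub_sq, inner_add_left, real_inner_smul_left]
  linarith

theorem IsProximalNormal.infDist_sq_eq (h : IsProximalNormal C c X N) (hc : c ≤ 1) :
    infDist (X + N) C ^ 2 = ‖N‖ ^ 2 := by
  refine le_antisymm ?_ ?_
  · simpa using infDist_sq_le h.mem (X + N)
  · simpa using h.le_infDist_sq hc 0

/-- Unless `Y = X`, moving from `X + N` in the direction `Y - X` increases the function of which
`indicatorEnvelope C Y` is the supremum. -/
theorem IsProximalNormal.eq_of_indicatorEnvelope_le (h : IsProximalNormal C c X N) (hc : c < 1)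
    {Y : V} (hY : HasFiniteEnvelope C Y)
    (hle : indicatorEnvelope C Y ≤ infDist (X + N) C ^ 2 - ‖X + N - Y‖ ^ 2) : Y = X := by
  have hgrowth := h.le_infDist_sq hc.le (Y - X)
  have hmax := (hY.le_indicatorEnvelope (X + (N + (1 - c) • (Y - X)))).trans hle
  rw [h.infDist_sq_eq hc.le] at hmax
  rw [← add_assoc] at hgrowth hmax
  have hshift : ‖X + N + (1 - c) • (Y - X) - Y‖ ^ 2 - ‖X + N - Y‖ ^ 2 =
      ‖N + (1 - c) • (Y - X)‖ ^ 2 - ‖N‖ ^ 2 - 2 * (1 - c) * ‖Y - X‖ ^ 2 := by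
    have h1 : X + N + (1 - c) • (Y - X) - Y = (N - (Y - X)) + (1 - c) • (Y - X) := by module
    have h2 : X + N - Y = N - (Y - X) := by abel
    rw [h1, h2, norm_add_sq_real, norm_add_sq_real N, inner_sub_left, real_inner_smul_right,
      real_inner_smul_right, real_inner_self_eq_norm_sq]
    ring
  have hzero : (1 - c) * ‖Y - X‖ ^ 2 ≤ 0 := by linarith
  have hsq : ‖Y - X‖ ^ 2 ≤ 0 := nonpos_of_mul_nonpos_right hzero (sub_pos.2 hc)
  rwa [sq_nonpos_iff, norm_eq_zero, sub_eq_zero] at hsq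

theorem IsProximalNormal.of_two_mul_inner_le (hX : X ∈ C) (hc : 0 < c) (hNX : inner ℝ N X = 0)
    (h : ∀ W ∈ C, 2 * inner ℝ (X + c⁻¹ • N) W - ‖W‖ ^ 2 ≤ ‖X‖ ^ 2) :
    IsProximalNormal C c X N := by
  refine ⟨hX, fun W hW => ?_⟩
  have hW := h W hW
  rw [inner_add_left, real_inner_smul_left, real_inner_comm] at hW
  have hinv : c⁻¹ * (2 * inner ℝ N W) ≤ ‖W - X‖ ^ 2 := by
    rw [norm_sub_sq_real]
    linarith
  rwa [inner_sub_right, hNX, sub_zero, ← inv_mul_le_iff₀ hc]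

end ProximalNormal

section LeastSquares

variable {V E : Type*} [NormedAddCommGroup V] [InnerProductSpace ℝ V] [FiniteDimensional ℝ V]
  [NormedAddCommGroup E] [InnerProductSpace ℝ E] {C : Set V} {A : V →ₗ[ℝ] E} {b : E} {X Y : V}

theorem exists_isMinOn_norm_map_sub_sq (b : E) (hC : IsClosed C) (hne : C.Nonempty) {a : ℝ}
    (ha : 0 < a) (hbelow : ∀ W ∈ C, a * ‖W‖ ^ 2 ≤ ‖A W‖ ^ 2) :
    ∃ X ∈ C, IsMinOn (fun W => ‖A W - b‖ ^ 2) C X := by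
  have : ProperSpace V := FiniteDimensional.proper ℝ V
  obtain ⟨X₀, hX₀⟩ := hne
  have hcont : Continuous fun W => ‖A W - b‖ ^ 2 :=
    ((A.continuous_of_finiteDimensional.sub continuous_const).norm).pow 2
  refine hcont.continuousOn.exists_isMinOn' hC hX₀ ?_
  have hgrow : Tendsto (fun W : V => √a * ‖W‖ - ‖b‖) (cocompact V) atTop :=
    tendsto_atTop_add_const_right _ _
      (tendsto_norm_cocompact_atTop.const_mul_atTop (Real.sqrt_pos.2 ha))
  filter_upwards [mem_inf_of_left (hgrow.eventually_ge_atTop ‖A X₀ - b‖),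
    mem_inf_of_right (mem_principal_self C)] with W hfar hW
  refine pow_le_pow_left₀ (norm_nonneg _) (hfar.trans ?_) 2
  have hAW : √a * ‖W‖ ≤ ‖A W‖ := by
    rw [← Real.sqrt_sq (norm_nonneg W), ← Real.sqrt_mul ha.le,
      Real.sqrt_le_left (norm_nonneg _)]
    exact hbelow W hW
  exact (sub_le_sub_right hAW _).trans (norm_sub_norm_le _ _)

variable [FiniteDimensional ℝ E]

/-- The relaxation `𝒬₂(ι_C)(X) + ‖A X - b‖²` of the least squares problem over `C`. -/
noncomputable def relaxedObjective (A : V →ₗ[ℝ] E) (b : E) (C : Set V) (X : V) : ℝ :=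
  indicatorEnvelope C X + ‖A X - b‖ ^ 2

/-- Half the negative gradient of `X ↦ ‖A X - b‖²`, so that `X + residual A b X` is the
associated point `(I - A⋆A) X + A⋆ b`. -/
noncomputable def residual (A : V →ₗ[ℝ] E) (b : E) (X : V) : V :=
  LinearMap.adjoint A (b - A X)

theorem residual_sub_residual (A : V →ₗ[ℝ] E) (b : E) (X Y : V) :
    residual A b X - residual A b Y = LinearMap.adjoint A (A (Y - X)) := by
  rw [residual, residual, ← map_sub, sub_sub_sub_cancel_left, map_sub A]

theorem norm_map_add_sub_sq (A : V →ₗ[ℝ] E) (b : E) (X D : V) :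
    ‖A (X + D) - b‖ ^ 2 = ‖A X - b‖ ^ 2 - 2 * inner ℝ (residual A b X) D + ‖A D‖ ^ 2 := by
  rw [residual, LinearMap.adjoint_inner_left, ← neg_sub (A X) b, inner_neg_left, map_add,
    add_sub_right_comm, norm_add_sq_real]
  ring

theorem norm_map_sub_sq_le_relaxedObjective (hA : ∀ D, ‖A D‖ ≤ ‖D‖) (hX : HasFiniteEnvelope C X)
    {W : V} (hW : IsProximalNormal C 1 W (X + residual A b X - W)) :
    ‖A W - b‖ ^ 2 ≤ relaxedObjective A b C X := by
  have hsup := hX.le_indicatorEnvelope (X + residual A b X)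
  have hnear := hW.infDist_sq_eq le_rfl
  have hexp := norm_map_add_sub_sq A b X (W - X)
  have hcontr := pow_le_pow_left₀ (norm_nonneg _) (hA (W - X)) 2
  rw [add_sub_cancel, norm_add_sub_sq] at hnear
  rw [add_sub_cancel] at hexp
  rw [hnear, add_sub_cancel_left] at hsup
  rw [relaxedObjective]
  linarith

theorem relaxedObjective_le_of_isMinOn (hA : ∀ D, ‖A D‖ ≤ ‖D‖) (hC : IsClosed C)
    (hfin : ∀ X, HasFiniteEnvelope C X) {X₀ : V} (hX₀ : X₀ ∈ C)
    (hmin : IsMinOn (fun W => ‖A W - b‖ ^ 2) C X₀) (X : V) :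
    relaxedObjective A b C X₀ ≤ relaxedObjective A b C X := by
  have : ProperSpace V := FiniteDimensional.proper ℝ V
  obtain ⟨W, hW⟩ := exists_isProximalNormal_one hC ⟨X₀, hX₀⟩ (X + residual A b X)
  calc relaxedObjective A b C X₀ ≤ ‖A X₀ - b‖ ^ 2 :=
        add_le_of_nonpos_left (indicatorEnvelope_nonpos_of_mem hX₀)
    _ ≤ ‖A W - b‖ ^ 2 := hmin hW.mem
    _ ≤ relaxedObjective A b C X := norm_map_sub_sq_le_relaxedObjective hA (hfin X) hW

theorem relaxedObjective_segment_le (hX : HasFiniteEnvelope C X) {W : V}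
    (hW : IsProximalNormal C 1 W (X + residual A b X - W)) {t : ℝ} (h0 : 0 ≤ t) (h1 : t ≤ 1) :
    relaxedObjective A b C (X + t • (W - X)) ≤ relaxedObjective A b C X -
      t * (indicatorEnvelope C X -
        (infDist (X + residual A b X) C ^ 2 - ‖residual A b X‖ ^ 2)) -
      t ^ 2 * (‖W - X‖ ^ 2 - ‖A (W - X)‖ ^ 2) := by
  have hseg := hX.indicatorEnvelope_segment_le (hasFiniteEnvelope_of_mem hW.mem) h0 h1
  have henv := mul_nonpos_of_nonneg_of_nonpos h0 (indicatorEnvelope_nonpos_of_mem hW.mem)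
  have hnear := hW.infDist_sq_eq le_rfl
  rw [add_sub_cancel] at hnear
  rw [relaxedObjective, relaxedObjective, norm_map_add_sub_sq, hnear, norm_add_sub_sq,
    real_inner_smul_right, map_smul, norm_smul, mul_pow, Real.norm_eq_abs, sq_abs]
  linarith

theorem adjoint_map_eq_self_of_norm_le (hA : ∀ D, ‖A D‖ ≤ ‖D‖) {D : V} (hD : ‖D‖ ≤ ‖A D‖) :
    LinearMap.adjoint A (A D) = D := by
  have hadj : ‖LinearMap.adjoint A (A D)‖ ≤ ‖A D‖ := by
    have h : ‖LinearMap.adjoint A (A D)‖ ^ 2 ≤ ‖A D‖ * ‖LinearMap.adjoint A (A D)‖ := by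
      rw [← real_inner_self_eq_norm_sq, LinearMap.adjoint_inner_left]
      exact (real_inner_le_norm _ _).trans (mul_le_mul_of_nonneg_left (hA _) (norm_nonneg _))
    nlinarith [norm_nonneg (A D), norm_nonneg (LinearMap.adjoint A (A D))]
  have hsq : ‖LinearMap.adjoint A (A D) - D‖ ^ 2 ≤ 0 := by
    rw [norm_sub_sq_real, LinearMap.adjoint_inner_left, real_inner_self_eq_norm_sq]
    have h₁ := pow_le_pow_left₀ (norm_nonneg _) hadj 2
    have h₂ := pow_le_pow_left₀ (norm_nonneg _) hD 2
    linarith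
  rwa [sq_nonpos_iff, norm_eq_zero, sub_eq_zero] at hsq

/-- Along the segment from `X` to `W`, the first-order term of `relaxedObjective_segment_le` gives
attainment at the associated point, and the second-order term makes `A` isometric on `W - X`. -/
theorem exists_isProximalNormal_of_isLocalMin (hA : ∀ D, ‖A D‖ ≤ ‖D‖) (hC : IsClosed C)
    (hne : C.Nonempty) (hfin : ∀ X, HasFiniteEnvelope C X)
    (hX : IsLocalMin (relaxedObjective A b C) X) :
    indicatorEnvelope C X ≤ infDist (X + residual A b X) C ^ 2 - ‖residual A b X‖ ^ 2 ∧
      ∃ W, IsProximalNormal C 1 W (residual A b W) ∧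
        W + residual A b W = X + residual A b X := by
  have : ProperSpace V := FiniteDimensional.proper ℝ V
  obtain ⟨W, hW⟩ := exists_isProximalNormal_one hC hne (X + residual A b X)
  obtain ⟨t, ht0, ht1, hmin⟩ : ∃ t : ℝ, 0 < t ∧ t < 1 ∧
      relaxedObjective A b C X ≤ relaxedObjective A b C (X + t • (W - X)) := by
    have hcont : Tendsto (fun t : ℝ => X + t • (W - X)) (𝓝[>] 0) (𝓝 X) := by
      have : ContinuousAt (fun t : ℝ => X + t • (W - X)) 0 := by fun_prop
      simpa [ContinuousAt] using this.tendsto.mono_left nhdsWithin_le_nhds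
    obtain ⟨t, hmin, ht⟩ := ((hcont.eventually hX).and (Ioo_mem_nhdsGT one_pos)).exists
    exact ⟨t, ht.1, ht.2, hmin⟩
  have hdescent := relaxedObjective_segment_le (hfin X) hW ht0.le ht1.le
  have hslack := (hfin X).le_indicatorEnvelope (X + residual A b X)
  have hcontr := pow_le_pow_left₀ (norm_nonneg _) (hA (W - X)) 2
  rw [add_sub_cancel_left] at hslack
  have hattained : t * (indicatorEnvelope C X -
      (infDist (X + residual A b X) C ^ 2 - ‖residual A b X‖ ^ 2)) ≤ 0 := by
    nlinarith [mul_nonneg (sq_nonneg t) (sub_nonneg.2 hcontr)]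
  have hisometric : t ^ 2 * (‖W - X‖ ^ 2 - ‖A (W - X)‖ ^ 2) ≤ 0 := by
    nlinarith [mul_nonneg ht0.le (sub_nonneg.2 hslack)]
  have hfixed : LinearMap.adjoint A (A (W - X)) = W - X :=
    adjoint_map_eq_self_of_norm_le hA <| le_of_sq_le_sq
      (sub_nonpos.1 (nonpos_of_mul_nonpos_right hisometric (by positivity))) (norm_nonneg _)
  have hshared : W + residual A b W = X + residual A b X := by
    rw [← residual_sub_residual A b, sub_eq_sub_iff_add_eq_add] at hfixed
    rw [← hfixed, add_comm]
  refine ⟨sub_nonpos.1 (nonpos_of_mul_nonpos_right hattained ht0), W, ?_, hshared⟩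
  rwa [← hshared, add_sub_cancel_left] at hW

theorem two_mul_norm_map_sub_sq_le {c c' : ℝ} (hX : IsProximalNormal C c X (residual A b X))
    (hY : IsProximalNormal C c' Y (residual A b Y)) :
    2 * ‖A (Y - X)‖ ^ 2 ≤ (c + c') * ‖Y - X‖ ^ 2 := by
  have hXY := hX.two_mul_inner_le Y hY.mem
  have hYX := hY.two_mul_inner_le X hX.mem
  have hdiff : inner ℝ (residual A b X) (Y - X) - inner ℝ (residual A b Y) (Y - X) =
      ‖A (Y - X)‖ ^ 2 := by
    rw [← inner_sub_left, residual_sub_residual, LinearMap.adjoint_inner_left,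
      real_inner_self_eq_norm_sq]
  rw [← neg_sub Y X, inner_neg_right, norm_neg] at hYX
  linarith

theorem eq_of_isLocalMin (hA : ∀ D, ‖A D‖ ≤ ‖D‖) (hC : IsClosed C)
    (hfin : ∀ X, HasFiniteEnvelope C X) {c : ℝ} (hc : c < 1)
    (hrip : ∀ U ∈ C, ∀ W ∈ C, W ≠ U → (c + 1) * ‖W - U‖ ^ 2 < 2 * ‖A (W - U)‖ ^ 2)
    (hX : IsLocalMin (relaxedObjective A b C) X) {P : V}
    (hP : IsProximalNormal C c P (X + residual A b X - P))
    (hY : IsLocalMin (relaxedObjective A b C) Y) : Y = X := by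
  obtain ⟨hX_attained, -⟩ := exists_isProximalNormal_of_isLocalMin hA hC ⟨P, hP.mem⟩ hfin hX
  obtain ⟨hY_attained, W, hW, hWY⟩ :=
    exists_isProximalNormal_of_isLocalMin hA hC ⟨P, hP.mem⟩ hfin hY
  obtain rfl : X = P :=
    hP.eq_of_indicatorEnvelope_le hc (hfin X) (by simpa using hX_attained)
  rw [add_sub_cancel_left] at hP
  obtain rfl : W = X := by
    by_contra hne
    exact (hrip X hP.mem W hW.mem hne).not_ge (two_mul_norm_map_sub_sq_le hP hW)
  exact hP.eq_of_indicatorEnvelope_le hc (hfin Y) (by simpa [hWY] using hY_attained)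

end LeastSquares

section SpectralSelection

variable {ι : Type*} [Fintype ι] {μ p : ι → ℝ} {I : Finset ι} {τ : ℝ}

theorem sum_mul_le_sum_of_threshold (hτ : 0 ≤ τ) (hI : ∀ i ∈ I, τ ≤ μ i)
    (hI' : ∀ i ∉ I, μ i ≤ τ) (h0 : ∀ i, 0 ≤ p i) (h1 : ∀ i, p i ≤ 1) (hp : ∑ i, p i ≤ I.card) :
    ∑ i, μ i * p i ≤ ∑ i ∈ I, μ i := by
  classical
  have hle : ∀ i, μ i * p i ≤ τ * p i + if i ∈ I then μ i - τ else 0 := by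
    intro i
    split_ifs with hi
    · nlinarith [mul_nonneg (sub_nonneg.2 (hI i hi)) (sub_nonneg.2 (h1 i))]
    · simpa using mul_le_mul_of_nonneg_right (hI' i hi) (h0 i)
  calc ∑ i, μ i * p i ≤ ∑ i, (τ * p i + if i ∈ I then μ i - τ else 0) :=
        Finset.sum_le_sum fun i _ => hle i
    _ = τ * (∑ i, p i) + (∑ i ∈ I, μ i - I.card * τ) := by
        rw [Finset.sum_add_distrib, ← Finset.mul_sum, Finset.sum_ite_mem, Finset.univ_inter,
          Finset.sum_sub_distrib, Finset.sum_const, nsmul_eq_mul]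
    _ ≤ ∑ i ∈ I, μ i := by linarith [mul_le_mul_of_nonneg_left hp hτ]

end SpectralSelection

open scoped InnerProductSpace

section EckartYoung

variable {𝕜 V W ι : Type*} [RCLike 𝕜] [NormedAddCommGroup V] [InnerProductSpace 𝕜 V]
  [NormedAddCommGroup W] [InnerProductSpace 𝕜 W] [Fintype ι]

theorem norm_map_sq_eq_sum (v : OrthonormalBasis ι 𝕜 V) {N : V →ₗ[𝕜] W}
    (hN : Pairwise fun i j => ⟪N (v i), N (v j)⟫_𝕜 = 0) (x : V) :
    ‖N x‖ ^ 2 = ∑ i, ‖N (v i)‖ ^ 2 * ‖⟪v i, x⟫_𝕜‖ ^ 2 := by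
  have hx : N x = ∑ i, ⟪v i, x⟫_𝕜 • N (v i) := by
    conv_lhs => rw [← v.sum_repr' x, map_sum]
    simp only [map_smul]
  have hdiag : ∀ i, ⟪N (v i), N x⟫_𝕜 = ⟪v i, x⟫_𝕜 * ((‖N (v i)‖ ^ 2 : ℝ) : 𝕜) := by
    intro i
    rw [hx, inner_sum, Finset.sum_eq_single i (fun j _ hji => by
      rw [inner_smul_right, hN hji.symm, mul_zero]) (by simp), inner_smul_right,
      inner_self_eq_norm_sq_to_K, RCLike.ofReal_pow]
  have hself : ((‖N x‖ ^ 2 : ℝ) : 𝕜) =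
      ((∑ i, ‖N (v i)‖ ^ 2 * ‖⟪v i, x⟫_𝕜‖ ^ 2 : ℝ) : 𝕜) := by
    rw [RCLike.ofReal_pow, ← inner_self_eq_norm_sq_to_K (𝕜 := 𝕜) (N x)]
    conv_lhs => rw [hx, sum_inner]
    simp only [← hx, inner_smul_left, hdiag]
    rw [RCLike.ofReal_sum]
    refine Finset.sum_congr rfl fun i _ => ?_
    rw [← mul_assoc, RCLike.conj_mul]
    push_cast
    ring
  exact_mod_cast hself

theorem sum_norm_map_sq_eq_sum (v : OrthonormalBasis ι 𝕜 V) {N : V →ₗ[𝕜] W}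
    (hN : Pairwise fun i j => ⟪N (v i), N (v j)⟫_𝕜 = 0) {P : V →ₗ[𝕜] V} (hP : P.IsSymmetric) :
    ∑ i, ‖N (P (v i))‖ ^ 2 = ∑ i, ‖N (v i)‖ ^ 2 * ‖P (v i)‖ ^ 2 := by
  calc ∑ i, ‖N (P (v i))‖ ^ 2 = ∑ i, ∑ j, ‖N (v j)‖ ^ 2 * ‖⟪P (v j), v i⟫_𝕜‖ ^ 2 :=
        Finset.sum_congr rfl fun i _ => by simp only [norm_map_sq_eq_sum v hN (P (v i)), hP _ _]
    _ = ∑ j, ‖N (v j)‖ ^ 2 * ‖P (v j)‖ ^ 2 := by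
        rw [Finset.sum_comm]
        simp only [← Finset.mul_sum, v.sum_sq_norm_inner_left]

variable [FiniteDimensional 𝕜 V]

theorem apply_starProjection_ker_orthogonal (T : V →ₗ[𝕜] W) (x : V) :
    T (T.kerᗮ.starProjection x) = T x := by
  have h := T.kerᗮ.sub_starProjection_mem_orthogonal x
  rw [Submodule.orthogonal_orthogonal, LinearMap.mem_ker, map_sub, sub_eq_zero] at h
  exact h.symm

theorem finrank_ker_orthogonal (T : V →ₗ[𝕜] W) :
    Module.finrank 𝕜 T.kerᗮ = Module.finrank 𝕜 T.range := by
  have horth := T.ker.finrank_add_finrank_orthogonal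
  have hrank := T.finrank_range_add_finrank_ker
  omega

theorem sum_norm_sq_starProjection (v : OrthonormalBasis ι 𝕜 V) (U : Submodule 𝕜 V) :
    ∑ i, ‖U.starProjection (v i)‖ ^ 2 = Module.finrank 𝕜 U := by
  have hproj : LinearMap.IsProj U (U.starProjection : V →ₗ[𝕜] V) :=
    ⟨U.starProjection_apply_mem, fun _ => Submodule.starProjection_eq_self_iff.2⟩
  have htrace := congrArg RCLike.re hproj.trace
  rw [LinearMap.trace_eq_sum_inner _ v, map_sum, RCLike.natCast_re] at htrace
  rw [← htrace]
  refine Finset.sum_congr rfl fun i _ => ?_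
  have h := U.starProjection_inner_eq_zero (v i) _ (U.starProjection_apply_mem (v i))
  rw [inner_sub_left, sub_eq_zero] at h
  rw [ContinuousLinearMap.coe_coe, h, inner_self_eq_norm_sq]

variable [FiniteDimensional 𝕜 W]

theorem sum_inner_comp_symmetric (v : OrthonormalBasis ι 𝕜 V) (S T : V →ₗ[𝕜] W) {P : V →ₗ[𝕜] V}
    (hP : P.IsSymmetric) :
    ∑ i, ⟪S (v i), T (P (v i))⟫_𝕜 = ∑ i, ⟪S (P (v i)), T (v i)⟫_𝕜 := by
  have hcomm := LinearMap.trace_mul_comm 𝕜 (S.adjoint ∘ₗ T) P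
  rw [LinearMap.trace_eq_sum_inner _ v, LinearMap.trace_eq_sum_inner _ v] at hcomm
  simpa only [Module.End.mul_apply, LinearMap.comp_apply, ← hP _ _,
    LinearMap.adjoint_inner_right] using hcomm

theorem sum_two_re_inner_sub_norm_sq_le (v : OrthonormalBasis ι 𝕜 V) {N T : V →ₗ[𝕜] W}
    {I : Finset ι} {τ : ℝ} (hN : Pairwise fun i j => ⟪N (v i), N (v j)⟫_𝕜 = 0) (hτ : 0 ≤ τ)
    (hI : ∀ i ∈ I, τ ≤ ‖N (v i)‖) (hI' : ∀ i ∉ I, ‖N (v i)‖ ≤ τ)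
    (hT : Module.finrank 𝕜 T.range ≤ I.card) :
    ∑ i, (2 * RCLike.re ⟪N (v i), T (v i)⟫_𝕜 - ‖T (v i)‖ ^ 2) ≤ ∑ i ∈ I, ‖N (v i)‖ ^ 2 := by
  let P : V →ₗ[𝕜] V := T.kerᗮ.starProjection
  have hP : P.IsSymmetric := T.kerᗮ.starProjection_isSymmetric
  have hcross : ∑ i, RCLike.re ⟪N (v i), T (v i)⟫_𝕜 = ∑ i, RCLike.re ⟪N (P (v i)), T (v i)⟫_𝕜 := by
    rw [← map_sum, ← map_sum, ← sum_inner_comp_symmetric v N T hP]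
    simp only [P, ContinuousLinearMap.coe_coe, apply_starProjection_ker_orthogonal]
  have hsquare : ∀ i, 2 * RCLike.re ⟪N (P (v i)), T (v i)⟫_𝕜 - ‖T (v i)‖ ^ 2 ≤
      ‖N (P (v i))‖ ^ 2 := fun i => by
    linarith [norm_sub_sq (𝕜 := 𝕜) (N (P (v i))) (T (v i)), sq_nonneg ‖N (P (v i)) - T (v i)‖]
  have hle_one : ∀ i, ‖P (v i)‖ ^ 2 ≤ 1 := fun i =>
    pow_le_one₀ (norm_nonneg _) (v.norm_eq_one i ▸ Submodule.norm_starProjection_apply_le _ _)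
  have hsum : ∑ i, ‖P (v i)‖ ^ 2 ≤ I.card := by
    simp only [P, ContinuousLinearMap.coe_coe, sum_norm_sq_starProjection, finrank_ker_orthogonal]
    exact_mod_cast hT
  calc ∑ i, (2 * RCLike.re ⟪N (v i), T (v i)⟫_𝕜 - ‖T (v i)‖ ^ 2)
      = ∑ i, (2 * RCLike.re ⟪N (P (v i)), T (v i)⟫_𝕜 - ‖T (v i)‖ ^ 2) := by
        simp only [Finset.sum_sub_distrib, ← Finset.mul_sum, hcross]
    _ ≤ ∑ i, ‖N (P (v i))‖ ^ 2 := Finset.sum_le_sum fun i _ => hsquare i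
    _ = ∑ i, ‖N (v i)‖ ^ 2 * ‖P (v i)‖ ^ 2 := sum_norm_map_sq_eq_sum v hN hP
    _ ≤ ∑ i ∈ I, ‖N (v i)‖ ^ 2 :=
        sum_mul_le_sum_of_threshold (sq_nonneg τ) (fun i hi => pow_le_pow_left₀ hτ (hI i hi) 2)
          (fun i hi => pow_le_pow_left₀ (norm_nonneg _) (hI' i hi) 2) (fun i => sq_nonneg _)
          hle_one hsum

theorem exists_orthonormalBasis_norm_map_eq_singularValues (T : V →ₗ[𝕜] W) {n : ℕ}
    (hn : Module.finrank 𝕜 V = n) :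
    ∃ v : OrthonormalBasis (Fin n) 𝕜 V, (Pairwise fun i j => ⟪T (v i), T (v j)⟫_𝕜 = 0) ∧
      ∀ i, ‖T (v i)‖ = T.singularValues i := by
  let v := T.isSymmetric_adjoint_comp_self.eigenvectorBasis hn
  have hinner : ∀ i j, ⟪T (v i), T (v j)⟫_𝕜 = (T.singularValues i ^ 2 : ℝ) * ⟪v i, v j⟫_𝕜 := by
    intro i j
    rw [← LinearMap.adjoint_inner_left, ← LinearMap.comp_apply,
      T.isSymmetric_adjoint_comp_self.apply_eigenvectorBasis, inner_smul_left,
      T.sq_singularValues_fin hn, RCLike.conj_ofReal]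
  refine ⟨v, fun i j hij => ?_, fun i => ?_⟩
  · exact (hinner i j).trans (by rw [v.inner_eq_zero hij, mul_zero])
  · have h := hinner i i
    rw [v.inner_eq_one, mul_one, inner_self_eq_norm_sq_to_K] at h
    exact (pow_left_inj₀ (norm_nonneg _) (T.singularValues_nonneg i) two_ne_zero).1
      (by exact_mod_cast h)

end EckartYoung

section Matrices

variable {𝕜 ι : Type*} [RCLike 𝕜] [Fintype ι] {m n : ℕ}

theorem inner_eq_sum_basis (v : OrthonormalBasis ι 𝕜 (EuclideanSpace 𝕜 (Fin n)))
    (X Y : Matrix (Fin m) (Fin n) 𝕜) :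
    inner ℝ X Y = ∑ i, RCLike.re ⟪X.toEuclideanLin (v i), Y.toEuclideanLin (v i)⟫_𝕜 := by
  have htrace : (Xᴴ * Y).trace =
      LinearMap.trace 𝕜 _ (X.toEuclideanLin.adjoint ∘ₗ Y.toEuclideanLin) := by
    rw [← Matrix.toEuclideanLin_conjTranspose_eq_adjoint,
      Matrix.toEuclideanLin_eq_toLin_orthonormal, Matrix.toEuclideanLin_eq_toLin_orthonormal,
      ← Matrix.toLin_mul, Matrix.trace_toLin_eq]
  change RCLike.re (Xᴴ * Y).trace = _
  rw [htrace, LinearMap.trace_eq_sum_inner _ v, map_sum]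
  simp only [LinearMap.comp_apply, LinearMap.adjoint_inner_right]

theorem norm_sq_eq_sum_basis (v : OrthonormalBasis ι 𝕜 (EuclideanSpace 𝕜 (Fin n)))
    (X : Matrix (Fin m) (Fin n) 𝕜) : ‖X‖ ^ 2 = ∑ i, ‖X.toEuclideanLin (v i)‖ ^ 2 := by
  rw [← real_inner_self_eq_norm_sq, inner_eq_sum_basis v]
  exact Finset.sum_congr rfl fun i _ => inner_self_eq_norm_sq _

theorem rank_eq_finrank_toEuclideanLin (X : Matrix (Fin m) (Fin n) 𝕜) :
    X.rank = Module.finrank 𝕜 X.toEuclideanLin.range := by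
  rw [Matrix.toEuclideanLin_eq_toLin_orthonormal]
  exact Matrix.rank_eq_finrank_range_toLin X _ _

theorem rank_sub_le (X Y : Matrix (Fin m) (Fin n) 𝕜) : (X - Y).rank ≤ X.rank + Y.rank := by
  simp only [rank_eq_finrank_toEuclideanLin]
  refine (Submodule.finrank_mono ?_).trans (Submodule.finrank_add_le_finrank_add_finrank _ _)
  rintro _ ⟨x, rfl⟩
  rw [map_sub, LinearMap.sub_apply]
  exact Submodule.sub_mem _ (Submodule.mem_sup_left (LinearMap.mem_range_self _ x))
    (Submodule.mem_sup_right (LinearMap.mem_range_self _ x))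

theorem real_smul_eq_coe_smul (r : ℝ) (X : Matrix (Fin m) (Fin n) 𝕜) : r • X = (r : 𝕜) • X := by
  ext i j
  simp [RCLike.real_smul_eq_coe_mul]

theorem rank_smul_le (r : 𝕜) (X : Matrix (Fin m) (Fin n) 𝕜) : (r • X).rank ≤ X.rank := by
  conv_lhs => rw [← X.mul_one, ← Matrix.mul_smul]
  exact Matrix.rank_mul_le_left X _

theorem rank_single_le (i : Fin m) (j : Fin n) (x : 𝕜) : (Matrix.single i j x).rank ≤ 1 := by
  rw [← mul_one x, ← smul_eq_mul, ← Matrix.smul_single, Matrix.single_eq_single_vecMulVec_single]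
  exact (rank_smul_le x _).trans (Matrix.rank_vecMulVec_le _ _)

theorem isClosed_rank_le (K : ℕ) : IsClosed {X : Matrix (Fin m) (Fin n) 𝕜 | X.rank ≤ K} := by
  let L : Matrix (Fin m) (Fin n) 𝕜 →ₗ[𝕜]
      EuclideanSpace 𝕜 (Fin n) →L[𝕜] EuclideanSpace 𝕜 (Fin m) :=
    (Matrix.toEuclideanLin ≪≫ₗ LinearMap.toContinuousLinearMap).toLinearMap
  have hopen := (isOpen_setOfPred_nat_le_rank (𝕜 := 𝕜) (E := EuclideanSpace 𝕜 (Fin n))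
    (F := EuclideanSpace 𝕜 (Fin m)) (K + 1)).preimage L.continuous_of_finiteDimensional
  convert hopen.isClosed_compl using 1
  ext X
  simp only [Set.mem_ofPred_eq, Set.mem_compl_iff, Set.mem_preimage, not_le]
  rw [rank_eq_finrank_toEuclideanLin, LinearMap.rank, ← Module.finrank_eq_rank, Nat.cast_lt,
    Nat.lt_succ_iff]
  rfl

theorem zero_mem_rank_le (K : ℕ) : (0 : Matrix (Fin m) (Fin n) 𝕜) ∈ {X | X.rank ≤ K} := by
  simp [Matrix.rank_zero]

theorem span_rank_le_eq_top {K : ℕ} (hK : 1 ≤ K) :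
    Submodule.span ℝ {X : Matrix (Fin m) (Fin n) 𝕜 | X.rank ≤ K} = ⊤ := by
  refine eq_top_iff.2 fun X _ => ?_
  induction X using Matrix.induction_on' with
  | h_zero => exact Submodule.zero_mem _
  | h_add X Y hX hY => exact Submodule.add_mem _ (hX trivial) (hY trivial)
  | h_std_basis i j x => exact Submodule.subset_span ((rank_single_le i j x).trans hK)

theorem hasFiniteEnvelope_rank_le {K : ℕ} (hK : 1 ≤ K) (X : Matrix (Fin m) (Fin n) 𝕜) :
    HasFiniteEnvelope {W | W.rank ≤ K} X := by
  refine hasFiniteEnvelope_of_span_eq_top ⟨0, zero_mem_rank_le K⟩ (fun W hW t => ?_) ?_ X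
  · rw [Set.mem_ofPred_eq, real_smul_eq_coe_smul]
    exact (rank_smul_le _ W).trans hW
  · exact span_rank_le_eq_top hK

/-- The matrix that agrees with `Z` on the basis vectors `v i` with `i ∈ I` and vanishes on the
others; a truncated singular value decomposition if `v` consists of right singular vectors. -/
noncomputable def truncation (v : OrthonormalBasis ι 𝕜 (EuclideanSpace 𝕜 (Fin n))) (I : Finset ι)
    (Z : Matrix (Fin m) (Fin n) 𝕜) : Matrix (Fin m) (Fin n) 𝕜 :=
  Matrix.toEuclideanLin.symm <|
    v.toBasis.constr 𝕜 <| (I : Set ι).indicator fun i => Z.toEuclideanLin (v i)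

section Truncation

variable {v : OrthonormalBasis ι 𝕜 (EuclideanSpace 𝕜 (Fin n))} {I : Finset ι}
  {Z : Matrix (Fin m) (Fin n) 𝕜}

theorem truncation_apply_of_mem {i : ι} (hi : i ∈ I) :
    (truncation v I Z).toEuclideanLin (v i) = Z.toEuclideanLin (v i) := by
  rw [truncation, LinearEquiv.apply_symm_apply, ← v.coe_toBasis, v.toBasis.constr_basis,
    Set.indicator_of_mem (Finset.mem_coe.2 hi)]

theorem truncation_apply_of_notMem {i : ι} (hi : i ∉ I) :
    (truncation v I Z).toEuclideanLin (v i) = 0 := by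
  rw [truncation, LinearEquiv.apply_symm_apply, ← v.coe_toBasis, v.toBasis.constr_basis,
    Set.indicator_of_notMem (Finset.mem_coe.not.2 hi)]

theorem rank_truncation_le (v : OrthonormalBasis ι 𝕜 (EuclideanSpace 𝕜 (Fin n))) (I : Finset ι)
    (Z : Matrix (Fin m) (Fin n) 𝕜) : (truncation v I Z).rank ≤ I.card := by
  rw [rank_eq_finrank_toEuclideanLin, truncation, LinearEquiv.apply_symm_apply,
    v.toBasis.constr_range]
  have hspan :
      Submodule.span 𝕜 (Set.range ((I : Set ι).indicator fun i => Z.toEuclideanLin (v i))) ≤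
        Submodule.span 𝕜 (Set.range fun i : I => Z.toEuclideanLin (v i)) := by
    rw [Submodule.span_le]
    rintro _ ⟨i, rfl⟩
    by_cases hi : i ∈ I
    · rw [Set.indicator_of_mem (Finset.mem_coe.2 hi)]
      exact Submodule.subset_span ⟨⟨i, hi⟩, rfl⟩
    · rw [Set.indicator_of_notMem (Finset.mem_coe.not.2 hi)]
      exact Submodule.zero_mem _
  exact (Submodule.finrank_mono hspan).trans
    ((finrank_range_le_card _).trans_eq (Fintype.card_coe I))

theorem norm_truncation_sq :
    ‖truncation v I Z‖ ^ 2 = ∑ i ∈ I, ‖Z.toEuclideanLin (v i)‖ ^ 2 := by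
  rw [norm_sq_eq_sum_basis v, ← Finset.sum_subset (Finset.subset_univ I) fun i _ hi => by
    rw [truncation_apply_of_notMem hi, norm_zero, zero_pow two_ne_zero]]
  exact Finset.sum_congr rfl fun i hi => by rw [truncation_apply_of_mem hi]

theorem inner_sub_truncation_eq_zero :
    inner ℝ (Z - truncation v I Z) (truncation v I Z) = 0 := by
  rw [inner_eq_sum_basis v]
  refine Finset.sum_eq_zero fun i _ => ?_
  rw [map_sub, LinearMap.sub_apply]
  by_cases hi : i ∈ I
  · rw [truncation_apply_of_mem hi, sub_self, inner_zero_left, map_zero]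
  · rw [truncation_apply_of_notMem hi, inner_zero_right, map_zero]

theorem isProximalNormal_truncation
    (hZ : Pairwise fun i j => ⟪Z.toEuclideanLin (v i), Z.toEuclideanLin (v j)⟫_𝕜 = 0)
    {c τ : ℝ} (hc : 0 < c) (hτ : 0 ≤ τ) (hI : ∀ i ∈ I, τ ≤ ‖Z.toEuclideanLin (v i)‖)
    (hI' : ∀ i ∉ I, ‖Z.toEuclideanLin (v i)‖ ≤ c * τ) :
    IsProximalNormal {W | W.rank ≤ I.card} c (truncation v I Z) (Z - truncation v I Z) := by
  set X := truncation v I Z with hX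
  -- Magnifying the discarded part by `c⁻¹` still leaves its singular values below the kept ones.
  set M := X + c⁻¹ • (Z - X) with hM
  have hM_mem : ∀ i ∈ I, M.toEuclideanLin (v i) = Z.toEuclideanLin (v i) := fun i hi => by
    simp [hM, hX, real_smul_eq_coe_smul, truncation_apply_of_mem hi]
  have hM_notMem : ∀ i ∉ I, M.toEuclideanLin (v i) = ((c⁻¹ : ℝ) : 𝕜) • Z.toEuclideanLin (v i) :=
    fun i hi => by simp [hM, hX, real_smul_eq_coe_smul, truncation_apply_of_notMem hi]
  have hM_orth : Pairwise fun i j => ⟪M.toEuclideanLin (v i), M.toEuclideanLin (v j)⟫_𝕜 = 0 := by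
    intro i j hij
    by_cases hi : i ∈ I <;> by_cases hj : j ∈ I <;>
      simp [hM_mem, hM_notMem, hi, hj, inner_smul_left, inner_smul_right, hZ hij]
  refine .of_two_mul_inner_le (rank_truncation_le v I Z) hc inner_sub_truncation_eq_zero
    fun W hW => ?_
  have hle := sum_two_re_inner_sub_norm_sq_le v (T := W.toEuclideanLin) hM_orth hτ
    (fun i hi => (hI i hi).trans_eq (by rw [hM_mem i hi]))
    (fun i hi => by
      rw [hM_notMem i hi, norm_smul, RCLike.norm_ofReal, abs_of_pos (inv_pos.2 hc),
        inv_mul_le_iff₀ hc]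
      exact hI' i hi)
    (rank_eq_finrank_toEuclideanLin W ▸ hW)
  rw [Finset.sum_sub_distrib, ← Finset.mul_sum, ← inner_eq_sum_basis, ← norm_sq_eq_sum_basis,
    Finset.sum_congr rfl fun i hi => by rw [hM_mem i hi], ← norm_truncation_sq] at hle
  exact hle

end Truncation

theorem exists_isProximalNormal_rank_le {K : ℕ} {Z : Matrix (Fin m) (Fin n) 𝕜} {c : ℝ}
    (hc : 0 < c) (hσ : sigma (K + 1) Z ≤ c * sigma K Z) :
    ∃ X, IsProximalNormal {W : Matrix (Fin m) (Fin n) 𝕜 | W.rank ≤ K} c X (Z - X) := by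
  obtain ⟨v, horth, hnorm⟩ :=
    exists_orthonormalBasis_norm_map_eq_singularValues Z.toEuclideanLin finrank_euclideanSpace_fin
  have hanti := Z.toEuclideanLin.singularValues_antitone
  let I : Finset (Fin n) := Finset.univ.filter fun i => (i : ℕ) < K
  have hmem : ∀ i, i ∈ I ↔ (i : ℕ) < K := fun i => by simp only [I, Finset.mem_filter_univ]
  have hlarge : ∀ i ∈ I, sigma K Z ≤ ‖Z.toEuclideanLin (v i)‖ := fun i hi =>
    hnorm i ▸ hanti (Nat.le_sub_one_of_lt ((hmem i).1 hi))
  have hsmall : ∀ i ∉ I, ‖Z.toEuclideanLin (v i)‖ ≤ c * sigma K Z := fun i hi =>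
    hnorm i ▸ (hanti (not_lt.1 (mt (hmem i).2 hi))).trans hσ
  have hcard : {W : Matrix (Fin m) (Fin n) 𝕜 | W.rank ≤ I.card} = {W | W.rank ≤ K} := by
    ext W
    simp only [I, Fin.card_filter_val_lt, Set.mem_ofPred_eq, le_min_iff, W.rank_le_width, true_and]
  exact ⟨_, hcard ▸ isProximalNormal_truncation horth hc
    (LinearMap.singularValues_nonneg _ _) hlarge hsmall⟩

end Matrices

section RestrictedIsometry

variable {𝕜 : Type*} [RCLike 𝕜] {m n : ℕ} {E : Type*} [NormedAddCommGroup E]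
  [InnerProductSpace ℝ E]

theorem norm_map_le_of_opNorm_le_one {V : Type*} [NormedAddCommGroup V] [InnerProductSpace ℝ V]
    [FiniteDimensional ℝ V] {A : V →ₗ[ℝ] E} (hA : opNorm A ≤ 1) (X : V) : ‖A X‖ ≤ ‖X‖ :=
  ((LinearMap.toContinuousLinearMap A).le_opNorm X).trans
    (mul_le_of_le_one_left (norm_nonneg X) hA)

theorem bddBelow_lrip_set (A : Matrix (Fin m) (Fin n) 𝕜 →ₗ[ℝ] E) (k : ℕ) :
    BddBelow {r : ℝ | ∃ X : Matrix (Fin m) (Fin n) 𝕜,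
      X ≠ 0 ∧ X.rank ≤ k ∧ r = ‖A X‖ ^ 2 / ‖X‖ ^ 2} :=
  ⟨0, by rintro _ ⟨X, -, -, rfl⟩; positivity⟩

theorem one_sub_lrip_mul_le (A : Matrix (Fin m) (Fin n) 𝕜 →ₗ[ℝ] E) {k : ℕ}
    {X : Matrix (Fin m) (Fin n) 𝕜} (hX : X.rank ≤ k) :
    (1 - lrip A k) * ‖X‖ ^ 2 ≤ ‖A X‖ ^ 2 := by
  rcases eq_or_ne X 0 with rfl | h0
  · simp
  · rw [← le_div_iff₀ (by positivity), lrip, sub_sub_cancel]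
    exact csInf_le (bddBelow_lrip_set A k) ⟨X, h0, hX, rfl⟩

theorem lrip_nonneg {A : Matrix (Fin m) (Fin n) 𝕜 →ₗ[ℝ] E} (hA : ∀ X, ‖A X‖ ≤ ‖X‖) (k : ℕ) :
    0 ≤ lrip A k := by
  rw [lrip, sub_nonneg]
  rcases Set.eq_empty_or_nonempty {r : ℝ | ∃ X : Matrix (Fin m) (Fin n) 𝕜,
      X ≠ 0 ∧ X.rank ≤ k ∧ r = ‖A X‖ ^ 2 / ‖X‖ ^ 2} with hempty | ⟨r, hr⟩
  · rw [hempty, Real.sInf_empty]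
    exact zero_le_one
  · refine (csInf_le (bddBelow_lrip_set A k) hr).trans ?_
    obtain ⟨X, -, -, rfl⟩ := hr
    exact div_le_one_of_le₀ (pow_le_pow_left₀ (norm_nonneg _) (hA X) 2) (sq_nonneg _)

theorem lrip_lt_one_of_sigma_lt {A : Matrix (Fin m) (Fin n) 𝕜 →ₗ[ℝ] E} (hA : ∀ X, ‖A X‖ ≤ ‖X‖)
    {Z : Matrix (Fin m) (Fin n) 𝕜} {K k : ℕ}
    (hgap : sigma (K + 1) Z < (1 - 2 * lrip A k) * sigma K Z) :
    lrip A k < 1 := by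
  have hδ : 0 < 1 - 2 * lrip A k :=
    pos_of_mul_pos_left ((LinearMap.singularValues_nonneg _ _).trans_lt hgap)
      (LinearMap.singularValues_nonneg _ _)
  linarith [lrip_nonneg hA k]

theorem add_one_mul_norm_sub_sq_lt (A : Matrix (Fin m) (Fin n) 𝕜 →ₗ[ℝ] E) {K : ℕ} {c : ℝ}
    (hc : c < 1 - 2 * lrip A (2 * K)) {U W : Matrix (Fin m) (Fin n) 𝕜} (hU : U.rank ≤ K)
    (hW : W.rank ≤ K) (hne : W ≠ U) : (c + 1) * ‖W - U‖ ^ 2 < 2 * ‖A (W - U)‖ ^ 2 := by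
  have hrip := one_sub_lrip_mul_le A (k := 2 * K) ((rank_sub_le W U).trans (by omega))
  have hpos : 0 < ‖W - U‖ ^ 2 := pow_pos (norm_sub_pos_iff.2 hne) 2
  linarith [mul_lt_mul_of_pos_right hc hpos]

end RestrictedIsometry

theorem exists_pos_lt_le_mul {a b d : ℝ} (ha : 0 ≤ a) (hb : 0 ≤ b) (h : a < d * b) :
    ∃ c, 0 < c ∧ c < d ∧ a ≤ c * b := by
  have hd : 0 < d := pos_of_mul_pos_left (ha.trans_lt h) hb
  have hb' : 0 < b := pos_of_mul_pos_right (ha.trans_lt h) hd.le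
  obtain ⟨c, hac, hcd⟩ := exists_between ((div_lt_iff₀ hb').2 h)
  exact ⟨c, (div_nonneg ha hb).trans_lt hac, hcd, ((div_lt_iff₀ hb').1 hac).le⟩

section Objective

variable {𝕜 : Type*} [RCLike 𝕜] {m n : ℕ} {E : Type*} [NormedAddCommGroup E]
  [InnerProductSpace ℝ E] {A : Matrix (Fin m) (Fin n) 𝕜 →ₗ[ℝ] E} {b : E} {K : ℕ}

theorem rankIndicator_eq_indicator (K : ℕ) :
    (rankIndicator K : Matrix (Fin m) (Fin n) 𝕜 → EReal) = {X | X.rank ≤ K}ᶜ.indicator ⊤ := by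
  ext X
  by_cases hX : X.rank ≤ K <;> simp [rankIndicator, hX]

theorem regObjective_eq_coe_relaxedObjective (A : Matrix (Fin m) (Fin n) 𝕜 →ₗ[ℝ] E) (b : E)
    (hK : 1 ≤ K) :
    regObjective A b K = fun X => ((relaxedObjective A b {W | W.rank ≤ K} X : ℝ) : EReal) := by
  have : ProperSpace (Matrix (Fin m) (Fin n) 𝕜) := FiniteDimensional.proper ℝ _
  funext X
  rw [regObjective, rankIndicator_eq_indicator, quadEnvelope_indicator (isClosed_rank_le K)
    ⟨0, zero_mem_rank_le K⟩ (hasFiniteEnvelope_rank_le hK X), relaxedObjective, EReal.coe_add]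

theorem isLocalMin_regObjective_iff (hK : 1 ≤ K) {X : Matrix (Fin m) (Fin n) 𝕜} :
    IsLocalMin (regObjective A b K) X ↔ IsLocalMin (relaxedObjective A b {W | W.rank ≤ K}) X := by
  simp only [regObjective_eq_coe_relaxedObjective A b hK, IsLocalMin, IsMinFilter,
    EReal.coe_le_coe_iff]

variable [FiniteDimensional ℝ E]

theorem exists_forall_regObjective_le (b : E) (hK : 1 ≤ K)
    (hA : ∀ X, ‖A X‖ ≤ ‖X‖) {k : ℕ} (hk : K ≤ k) (hrip : lrip A k < 1) :
    ∃ X, ∀ Y, regObjective A b K X ≤ regObjective A b K Y := by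
  obtain ⟨X, hX, hmin⟩ := exists_isMinOn_norm_map_sub_sq (A := A) b (isClosed_rank_le K)
    ⟨0, zero_mem_rank_le K⟩ (sub_pos.2 hrip) fun W hW =>
      one_sub_lrip_mul_le A (hW.trans hk)
  rw [regObjective_eq_coe_relaxedObjective A b hK]
  exact ⟨X, fun Y => EReal.coe_le_coe_iff.2 (relaxedObjective_le_of_isMinOn hA
    (isClosed_rank_le K) (hasFiniteEnvelope_rank_le hK) hX hmin Y)⟩

theorem assocPoint_eq_add_residual (A : Matrix (Fin m) (Fin n) 𝕜 →ₗ[ℝ] E) (b : E)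
    (X : Matrix (Fin m) (Fin n) 𝕜) : assocPoint A b X = X + residual A b X := by
  rw [assocPoint, residual, map_sub]
  abel

theorem eq_of_isLocalMin_regObjective (hK : 1 ≤ K) (hA : ∀ X, ‖A X‖ ≤ ‖X‖)
    {X Y : Matrix (Fin m) (Fin n) 𝕜} (hX : IsLocalMin (regObjective A b K) X)
    (hgap : sigma (K + 1) (assocPoint A b X) <
      (1 - 2 * lrip A (2 * K)) * sigma K (assocPoint A b X))
    (hY : IsLocalMin (regObjective A b K) Y) : Y = X := by
  obtain ⟨c, hc0, hc, hσ⟩ := exists_pos_lt_le_mul (LinearMap.singularValues_nonneg _ _)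
    (LinearMap.singularValues_nonneg _ _) hgap
  obtain ⟨P, hP⟩ := exists_isProximalNormal_rank_le hc0 hσ
  rw [assocPoint_eq_add_residual] at hP
  rw [isLocalMin_regObjective_iff hK] at hX hY
  have hc1 : c < 1 := by linarith [lrip_nonneg hA (2 * K)]
  exact eq_of_isLocalMin hA (isClosed_rank_le K) (hasFiniteEnvelope_rank_le hK) hc1
    (fun _ hU _ hW => add_one_mul_norm_sub_sq_lt A hc hU hW) hX hP hY

end Objective

end LowRank

theorem theorem6p3_general {𝕜 : Type*} [RCLike 𝕜] {n₁ n₂ : ℕ} {E : Type*} [NormedAddCommGroup E]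
    [InnerProductSpace ℝ E] [FiniteDimensional ℝ E]
    (A : Matrix (Fin n₁) (Fin n₂) 𝕜 →ₗ[ℝ] E) (b : E) (K : ℕ) (hK : 1 ≤ K)
    (hA : LowRank.opNorm A ≤ 1) :
    (LowRank.lrip A K < 1 →
      ∃ X' : Matrix (Fin n₁) (Fin n₂) 𝕜,
        ∀ X, LowRank.regObjective A b K X' ≤ LowRank.regObjective A b K X) ∧
    (∀ X' : Matrix (Fin n₁) (Fin n₂) 𝕜,
      IsLocalMin (LowRank.regObjective A b K) X' →
      LowRank.sigma (K + 1) (LowRank.assocPoint A b X') <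
        (1 - 2 * LowRank.lrip A (2 * K)) * LowRank.sigma K (LowRank.assocPoint A b X') →
      (∀ X, LowRank.regObjective A b K X' ≤ LowRank.regObjective A b K X) ∧
      (∀ Y : Matrix (Fin n₁) (Fin n₂) 𝕜,
        IsLocalMin (LowRank.regObjective A b K) Y → Y = X')) := by
  have hcontr := LowRank.norm_map_le_of_opNorm_le_one hA
  refine ⟨LowRank.exists_forall_regObjective_le b hK hcontr le_rfl, fun X' hX' hgap => ?_⟩
  have hunique : ∀ Y, IsLocalMin (LowRank.regObjective A b K) Y → Y = X' := fun Y hY =>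
    LowRank.eq_of_isLocalMin_regObjective hK hcontr hX' hgap hY
  have hrip := LowRank.lrip_lt_one_of_sigma_lt hcontr hgap
  obtain ⟨X₀, hX₀⟩ := LowRank.exists_forall_regObjective_le b hK hcontr (by omega) hrip
  exact ⟨hunique X₀ (.of_forall hX₀) ▸ hX₀, hunique⟩

/-- `A` is a real-linear operator on the real or complex `n₁ × n₂` matrices (Frobenius norm) with
values in a finite-dimensional real inner product space, such as `ℝᵐ`, or `ℂᵐ` with `Re ⟪·,·⟫`;
a complex-linear `A` is a special case, with the same norm and the same adjoint. -/
theorem theorem6p3 {𝕜 : Type*} [RCLike 𝕜] {n₁ n₂ : ℕ} {E : Type*} [NormedAddCommGroup E]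
    [InnerProductSpace ℝ E] [FiniteDimensional ℝ E]
    (A : Matrix (Fin n₁) (Fin n₂) 𝕜 →ₗ[ℝ] E) (b : E) (K : ℕ) (hK : 1 ≤ K)
    (hA : LowRank.opNorm A < 1) :
    (LowRank.lrip A K < 1 →
      ∃ X' : Matrix (Fin n₁) (Fin n₂) 𝕜,
        ∀ X, LowRank.regObjective A b K X' ≤ LowRank.regObjective A b K X) ∧
    (∀ X' : Matrix (Fin n₁) (Fin n₂) 𝕜,
      (∀ X, LowRank.regObjective A b K X' ≤ LowRank.regObjective A b K X) →
      LowRank.sigma (K + 1) (LowRank.assocPoint A b X') <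
        (1 - 2 * LowRank.lrip A (2 * K)) * LowRank.sigma K (LowRank.assocPoint A b X') →
      (∀ Y : Matrix (Fin n₁) (Fin n₂) 𝕜,
        (∀ X, LowRank.regObjective A b K Y ≤ LowRank.regObjective A b K X) → Y = X') ∧
      (∀ Y : Matrix (Fin n₁) (Fin n₂) 𝕜,
        IsLocalMin (LowRank.regObjective A b K) Y → Y = X')) := by
  obtain ⟨hexists, hlocal⟩ := theorem6p3_general A b K hK hA.le
  refine ⟨hexists, fun X' hX' hgap => ?_⟩
  have hunique := (hlocal X' (.of_forall hX') hgap).2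
  exact ⟨fun Y hY => hunique Y (.of_forall hY), hunique⟩
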